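/- For a finite simple graph $G$ of order $n$ let $q_1(G)\ge q_2(G)\ge\cdots\ge q_n(G)$ denote the eigenvalues, with multiplicity, of its signless Laplacian matrix $Q(G)=D(G)+A(G)$, where $D(G)$ is the diagonal matrix of vertex degrees and $A(G)$ the adjacency matrix, and let $\overline{G}$ denote the complement of $G$. Theorem. Let $G$ be a connected graph of order $n\ge 6$. If $q_2(G)\le n-3$, then $$q_2(G)+q_2(\overline{G})\le 2n-5,$$ with equality holding if and only if $G$ is isomorphic to $K_{3,3}$ or to one of the following eight bipartite graphs on the six vertices $a_1,a_2,a_3,b_1,b_2,b_3$: - $H_1$ (the path $P_6$), with edges $a_1b_1,a_1b_2,a_2b_2,a_2b_3,a_3b_3$; - $H_2$ (two adjacent vertices, each with two pendant vertices), with edges $a_1b_1,a_1b_2,a_1b_3,a_2b_1,a_3b_1$; - $H_3$ (a $4$-cycle with a pendant path of length two), with edges $a_1b_1,a_1b_2,a_2b_1,a_2b_2,a_2b_3,a_3b_3$; - $H_4$ (a $4$-cycle with a pendant vertex at each of two adjacent vertices), with edges $a_1b_1,a_1b_2,a_2b_1,a_2b_2,a_2b_3,a_3b_2$; - $H_5$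 (the cycle $C_6$), with edges $a_1b_2,a_1b_3,a_2b_1,a_2b_3,a_3b_1,a_3b_2$; - $H_6$ ($K_{2,3}$ with a pendant vertex at a vertex of degree $2$), with edges $a_1b_1,a_1b_2,a_2b_1,a_2b_2,a_3b_1,a_3b_2,a_3b_3$; - $H_7$ ($C_6$ with one long diagonal), with edges $a_1b_1,a_1b_2,a_2b_1,a_2b_2,a_2b_3,a_3b_2,a_3b_3$; - $H_8$ ($K_{3,3}$ with one edge removed), with edges $a_1b_1,a_1b_2,a_1b_3,a_2b_1,a_2b_2,a_2b_3,a_3b_1,a_3b_2$. -/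

import Mathlib

namespace SignlessNG

/-- The signless Laplacian matrix `Q(G) = D(G) + A(G)` of a finite simple graph, over `ℝ`. -/
def signlessLaplacian {V : Type*} [Fintype V] [DecidableEq V] (G : SimpleGraph V)
    [DecidableRel G.Adj] : Matrix V V ℝ :=
  G.degMatrix ℝ + G.adjMatrix ℝ

theorem signlessLaplacian_isHermitian {V : Type*} [Fintype V] [DecidableEq V] (G : SimpleGraph V)
    [DecidableRel G.Adj] : (signlessLaplacian G).IsHermitian := by
  unfold signlessLaplacian Matrix.IsHermitian
  rw [Matrix.conjTranspose_eq_transpose_of_trivial, Matrix.transpose_add,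
    (G.isSymm_degMatrix (R := ℝ)).eq, SimpleGraph.transpose_adjMatrix]

/-- The signless Laplacian eigenvalues of `G`, counted with multiplicity, in non-increasing order.
The index starts at `0`: the value at `i` is `q_{i+1}(G)`. -/
noncomputable def signlessEigenvalue {V : Type*} [Fintype V] [DecidableEq V] (G : SimpleGraph V)
    [DecidableRel G.Adj] : Fin (Fintype.card V) → ℝ :=
  (signlessLaplacian_isHermitian G).eigenvalues₀

/-- The second largest signless Laplacian eigenvalue `q₂(G)` of a graph with at least two
vertices. -/
noncomputable def q₂ {V : Type*} [Fintype V] [DecidableEq V] (G : SimpleGraph V)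
    [DecidableRel G.Adj] (hV : 2 ≤ Fintype.card V) : ℝ :=
  signlessEigenvalue G ⟨1, hV⟩

/-- The graph on the six vertices `0, …, 5` with the given edges. In the graphs `H₁`, …, `H₈` below
`0, 1, 2` is the upper row and `3, 4, 5` the lower row of the drawing, from left to right. -/
def sixGraph (E : Finset (Sym2 (Fin 6))) : SimpleGraph (Fin 6) :=
  SimpleGraph.fromEdgeSet (E : Set (Sym2 (Fin 6)))

/-- `H₁`, the path on six vertices. -/
def H₁ : SimpleGraph (Fin 6) :=
  sixGraph {s(0, 3), s(0, 4), s(1, 4), s(1, 5), s(2, 5)}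

/-- `H₂`, the tree of two adjacent vertices with two pendant vertices attached to each. -/
def H₂ : SimpleGraph (Fin 6) :=
  sixGraph {s(0, 3), s(0, 4), s(0, 5), s(1, 3), s(2, 3)}

/-- `H₃`, a 4-cycle with a pendant path of length two. -/
def H₃ : SimpleGraph (Fin 6) :=
  sixGraph {s(0, 3), s(0, 4), s(1, 3), s(1, 4), s(1, 5), s(2, 5)}

/-- `H₄`, a 4-cycle with a pendant vertex at each of two adjacent vertices. -/
def H₄ : SimpleGraph (Fin 6) :=
  sixGraph {s(0, 3), s(0, 4), s(1, 3), s(1, 4), s(1, 5), s(2, 4)}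

/-- `H₅`, the 6-cycle. -/
def H₅ : SimpleGraph (Fin 6) :=
  sixGraph {s(0, 4), s(0, 5), s(1, 3), s(1, 5), s(2, 3), s(2, 4)}

/-- `H₆`, the complete bipartite graph `K_{2,3}` with a pendant vertex at a vertex of degree 2. -/
def H₆ : SimpleGraph (Fin 6) :=
  sixGraph {s(0, 3), s(0, 4), s(1, 3), s(1, 4), s(2, 3), s(2, 4), s(2, 5)}

/-- `H₇`, the 6-cycle with one long diagonal. -/
def H₇ : SimpleGraph (Fin 6) :=
  sixGraph {s(0, 3), s(0, 4), s(1, 3), s(1, 4), s(1, 5), s(2, 4), s(2, 5)}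

/-- `H₈`, the complete bipartite graph `K_{3,3}` with one edge removed. -/
def H₈ : SimpleGraph (Fin 6) :=
  sixGraph {s(0, 3), s(0, 4), s(0, 5), s(1, 3), s(1, 4), s(1, 5), s(2, 3), s(2, 4)}

end SignlessNG

/-! Write `n` for the order and `m` for the number of edges. Since `Q(G) + Q(Gᶜ) = (n-2)I + J` and
both forms are nonnegative, the form of `Gᶜ` is at most `(n-2)|x|²` on vectors of sum zero.
Courant–Fischer gives `q₂(Gᶜ) ≤ n-2` (`q₂_compl_le`), and the inequality follows at once.

Equality means `q₂(G) = n-3` and `q₂(Gᶜ) = n-2`. The second equation yields a nonzero `x` of sum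
zero on which the form of `G` vanishes. It changes sign across every edge, so connectedness makes it
a multiple of a sign vector `s`, and `G` is bipartite with equal parts. As a subgraph of the
balanced complete bipartite graph, `G` has `q₂(G) ≤ n/2` (`q₂_le_of_balanced`); hence `n-3 ≤ n/2`
and `n = 6`.

Now `q₂(G) = 3 = n/2` produces a nonzero vector with sum zero on each part and opposite values at
each missing crossing pair (`exists_kernel_of_q₂_eq`). A connected balanced bipartite graph on six
vertices is, up to isomorphism, a spider or one of the nine listed graphs, and only the spider has
no such vector. Conversely, such a vector `y` gives equality through the test spaces `span(1, y)`
for `G` and `span(1, s)` for `Gᶜ`. -/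

namespace SignlessNG

open Matrix

/-! ### Courant–Fischer bounds for the second eigenvalue -/

section Eigenvalues

variable {n : Type*} [Fintype n] [DecidableEq n] {A : Matrix n n ℝ}

/-- An orthonormal eigenbasis realizing the eigenvalues in non-increasing order. -/
theorem exists_sorted_eigenbasis (hA : A.IsHermitian) :
    ∃ b : OrthonormalBasis (Fin (Fintype.card n)) ℝ (EuclideanSpace ℝ n),
      ∀ i, A *ᵥ (b i).ofLp = hA.eigenvalues₀ i • (b i).ofLp := by
  let σ : Fin (Fintype.card n) ≃ n := Fintype.equivOfCardEq (Fintype.card_fin _)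
  refine ⟨hA.eigenvectorBasis.reindex σ.symm, fun i => ?_⟩
  have h := hA.mulVec_eigenvectorBasis (σ i)
  have h' : hA.eigenvalues (σ i) = hA.eigenvalues₀ i := by
    simp [Matrix.IsHermitian.eigenvalues, σ]
  rw [h'] at h
  simpa using h

/-- The span of the top two eigenvectors meets the hyperplane orthogonal to `w`, and on that span
the Rayleigh quotient is at least the second eigenvalue. -/
theorem exists_orthogonal_eigenvalue_one_le (hA : A.IsHermitian) (hn : 2 ≤ Fintype.card n)
    (w : n → ℝ) :
    ∃ x : n → ℝ, x ≠ 0 ∧ w ⬝ᵥ x = 0 ∧ hA.eigenvalues₀ ⟨1, hn⟩ * (x ⬝ᵥ x) ≤ x ⬝ᵥ (A *ᵥ x) := by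
  obtain ⟨b, hb⟩ := exists_sorted_eigenbasis hA
  let i₀ : Fin (Fintype.card n) := ⟨0, by omega⟩
  let i₁ : Fin (Fintype.card n) := ⟨1, hn⟩
  have hmono : hA.eigenvalues₀ i₁ ≤ hA.eigenvalues₀ i₀ :=
    hA.eigenvalues₀_antitone (by simp [i₀, i₁, Fin.le_def])
  set u := (b i₀).ofLp with hu
  set v := (b i₁).ofLp with hv
  have inner_eq : ∀ i j, (b i).ofLp ⬝ᵥ (b j).ofLp = if i = j then 1 else 0 := by
    intro i j
    rw [← orthonormal_iff_ite.1 b.orthonormal i j, EuclideanSpace.inner_eq_star_dotProduct,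
      dotProduct_comm]
    simp
  have huu : u ⬝ᵥ u = 1 := by simp [hu, inner_eq]
  have hvv : v ⬝ᵥ v = 1 := by simp [hv, inner_eq]
  have huv : u ⬝ᵥ v = 0 := by simp [hu, hv, inner_eq, i₀, i₁]
  have hvu : v ⬝ᵥ u = 0 := by rw [dotProduct_comm, huv]
  obtain ⟨c, d, hcd, hw⟩ : ∃ c d : ℝ, 0 < c ^ 2 + d ^ 2 ∧ c * (w ⬝ᵥ u) + d * (w ⬝ᵥ v) = 0 := by
    by_cases h : w ⬝ᵥ u = 0
    · exact ⟨1, 0, by norm_num, by simp [h]⟩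
    · exact ⟨w ⬝ᵥ v, -(w ⬝ᵥ u), by rw [neg_sq]; have := sq_pos_iff.2 h; positivity, by ring⟩
  have hxx : (c • u + d • v) ⬝ᵥ (c • u + d • v) = c ^ 2 + d ^ 2 := by
    simp only [dotProduct_add, add_dotProduct, smul_dotProduct, dotProduct_smul, huu, hvv, huv,
      hvu, smul_eq_mul]
    ring
  refine ⟨c • u + d • v, ?_, ?_, ?_⟩
  · intro h
    rw [h] at hxx
    simp only [dotProduct_zero] at hxx
    linarith
  · simpa [dotProduct_add, dotProduct_smul] using hw
  · rw [hxx, mulVec_add, mulVec_smul, mulVec_smul, hu, hv, hb, hb, ← hu, ← hv]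
    simp only [dotProduct_add, add_dotProduct, smul_dotProduct, dotProduct_smul, huu, hvv, huv,
      hvu, smul_eq_mul]
    nlinarith [mul_nonneg (sq_nonneg c) (sub_nonneg.2 hmono)]

/-- Some nontrivial combination is orthogonal to the top eigenvector, which leaves only the lower
eigenvalues. As `y` and `z` may be dependent, only the coefficients are known to be nonzero. -/
theorem exists_combination_le_eigenvalue_one (hA : A.IsHermitian) (hn : 2 ≤ Fintype.card n)
    (y z : n → ℝ) :
    ∃ c d : ℝ, 0 < c ^ 2 + d ^ 2 ∧ (c • y + d • z) ⬝ᵥ (A *ᵥ (c • y + d • z)) ≤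
      hA.eigenvalues₀ ⟨1, hn⟩ * ((c • y + d • z) ⬝ᵥ (c • y + d • z)) := by
  obtain ⟨b, hb⟩ := exists_sorted_eigenbasis hA
  let i₀ : Fin (Fintype.card n) := ⟨0, by omega⟩
  set u := (b i₀).ofLp with hu
  obtain ⟨c, d, hcd, hw⟩ : ∃ c d : ℝ, 0 < c ^ 2 + d ^ 2 ∧ c * (u ⬝ᵥ y) + d * (u ⬝ᵥ z) = 0 := by
    by_cases h : u ⬝ᵥ y = 0
    · exact ⟨1, 0, by norm_num, by simp [h]⟩
    · exact ⟨u ⬝ᵥ z, -(u ⬝ᵥ y), by rw [neg_sq]; have := sq_pos_iff.2 h; positivity, by ring⟩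
  refine ⟨c, d, hcd, ?_⟩
  set x := c • y + d • z with hx
  have hux : u ⬝ᵥ x = 0 := by simpa [hx, dotProduct_add, dotProduct_smul] using hw
  have parseval : ∀ p q : n → ℝ,
      p ⬝ᵥ q = ∑ i, ((b i).ofLp ⬝ᵥ p) * ((b i).ofLp ⬝ᵥ q) := by
    intro p q
    have h := b.sum_inner_mul_inner (WithLp.toLp 2 p) (WithLp.toLp 2 q)
    simp only [EuclideanSpace.inner_eq_star_dotProduct, star_trivial] at h
    rw [dotProduct_comm p q, ← h]
    exact Finset.sum_congr rfl fun i _ => by rw [dotProduct_comm q]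
  -- In the eigenbasis the inequality holds term by term; the `i₀` term vanishes.
  rw [parseval x (A *ᵥ x), parseval x x, Finset.mul_sum]
  refine Finset.sum_le_sum fun i _ => ?_
  have hi : (b i).ofLp ⬝ᵥ (A *ᵥ x) = hA.eigenvalues₀ i * ((b i).ofLp ⬝ᵥ x) := by
    have hT : Aᵀ = A := by simpa [Matrix.conjTranspose_eq_transpose_of_trivial] using hA.eq
    rw [dotProduct_mulVec, ← mulVec_transpose, hT, hb, smul_dotProduct, smul_eq_mul]
  rw [hi]
  by_cases h0 : i = i₀
  · subst h0
    rw [← hu, hux]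
    simp
  · have hle : hA.eigenvalues₀ i ≤ hA.eigenvalues₀ ⟨1, hn⟩ := by
      apply hA.eigenvalues₀_antitone
      have : i.1 ≠ 0 := fun h => h0 (Fin.ext h)
      simp only [Fin.le_def]
      omega
    nlinarith [mul_nonneg (sq_nonneg ((b i).ofLp ⬝ᵥ x)) (sub_nonneg.2 hle)]

end Eigenvalues

/-! ### The quadratic form of the signless Laplacian -/

section QuadraticForm

variable {V : Type*} [Fintype V] [DecidableEq V] (G : SimpleGraph V) [DecidableRel G.Adj]

/-- The form is a sum of squares over edges; ordered pairs count each edge twice, hence the halving.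
-/
theorem dotProduct_signlessLaplacian_mulVec (x : V → ℝ) :
    x ⬝ᵥ (signlessLaplacian G *ᵥ x) =
      (∑ u, ∑ v, if G.Adj u v then (x u + x v) ^ 2 else 0) / 2 := by
  have hdeg : ∀ u, (G.degree u : ℝ) = ∑ v, if G.Adj u v then (1 : ℝ) else 0 := by
    intro u
    simp [← SimpleGraph.card_neighborFinset_eq_degree, SimpleGraph.neighborFinset_eq_filter]
  have hQ : x ⬝ᵥ (signlessLaplacian G *ᵥ x) =
      ∑ u, ∑ v, if G.Adj u v then x u ^ 2 + x u * x v else 0 := by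
    rw [signlessLaplacian, add_mulVec, dotProduct_add]
    simp only [dotProduct, SimpleGraph.degMatrix_mulVec_apply, hdeg]
    rw [← Finset.sum_add_distrib]
    refine Finset.sum_congr rfl fun u _ => ?_
    simp only [mulVec, dotProduct, SimpleGraph.adjMatrix_apply, Finset.sum_mul, Finset.mul_sum]
    rw [← Finset.sum_add_distrib]
    refine Finset.sum_congr rfl fun v _ => ?_
    split_ifs <;> ring
  have hswap : x ⬝ᵥ (signlessLaplacian G *ᵥ x) =
      ∑ u, ∑ v, if G.Adj u v then x v ^ 2 + x u * x v else 0 := by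
    rw [hQ, Finset.sum_comm]
    refine Finset.sum_congr rfl fun u _ => Finset.sum_congr rfl fun v _ => ?_
    simp only [G.adj_comm v u, mul_comm]
  have h2 : x ⬝ᵥ (signlessLaplacian G *ᵥ x) + x ⬝ᵥ (signlessLaplacian G *ᵥ x) =
      ∑ u, ∑ v, if G.Adj u v then (x u + x v) ^ 2 else 0 := by
    nth_rewrite 1 [hQ]
    rw [hswap]
    simp only [← Finset.sum_add_distrib]
    refine Finset.sum_congr rfl fun u _ => Finset.sum_congr rfl fun v _ => ?_
    split_ifs <;> ring
  linarith

theorem signlessLaplacian_form_nonneg (x : V → ℝ) : 0 ≤ x ⬝ᵥ (signlessLaplacian G *ᵥ x) := by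
  rw [dotProduct_signlessLaplacian_mulVec]
  have : 0 ≤ ∑ u, ∑ v, if G.Adj u v then (x u + x v) ^ 2 else 0 :=
    Finset.sum_nonneg fun u _ => Finset.sum_nonneg fun v _ => by split_ifs <;> positivity
  linarith

theorem signlessLaplacian_form_eq_zero_iff {x : V → ℝ} :
    x ⬝ᵥ (signlessLaplacian G *ᵥ x) = 0 ↔ ∀ u v, G.Adj u v → x u + x v = 0 := by
  have hnn : ∀ u v, 0 ≤ if G.Adj u v then (x u + x v) ^ 2 else 0 := fun u v => by
    split_ifs <;> positivity
  rw [dotProduct_signlessLaplacian_mulVec, div_eq_zero_iff, or_iff_left (by norm_num),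
    Finset.sum_eq_zero_iff_of_nonneg fun u _ => Finset.sum_nonneg fun v _ => hnn u v]
  simp only [Finset.mem_univ, true_implies]
  refine forall_congr' fun u => ?_
  rw [Finset.sum_eq_zero_iff_of_nonneg fun v _ => hnn u v]
  simp

theorem signlessLaplacian_form_one :
    (fun _ => (1 : ℝ)) ⬝ᵥ (signlessLaplacian G *ᵥ (fun _ => 1)) =
      4 * (G.edgeFinset.card : ℝ) := by
  have h : ∑ u, ∑ v, (if G.Adj u v then (1 : ℝ) else 0) = 2 * (G.edgeFinset.card : ℝ) := by
    have := G.sum_degrees_eq_twice_card_edges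
    rw [← Nat.cast_ofNat, ← Nat.cast_mul, ← this, Nat.cast_sum]
    refine Finset.sum_congr rfl fun u _ => ?_
    simp [← SimpleGraph.card_neighborFinset_eq_degree, SimpleGraph.neighborFinset_eq_filter]
  have h4 : ∑ u, ∑ v, (if G.Adj u v then ((1 : ℝ) + 1) ^ 2 else 0) =
      4 * ∑ u, ∑ v, (if G.Adj u v then (1 : ℝ) else 0) := by
    simp only [Finset.mul_sum]
    refine Finset.sum_congr rfl fun u _ => Finset.sum_congr rfl fun v _ => ?_
    split_ifs <;> norm_num
  rw [dotProduct_signlessLaplacian_mulVec, h4, h]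
  ring

theorem signlessLaplacian_form_add_compl (x : V → ℝ) :
    x ⬝ᵥ (signlessLaplacian G *ᵥ x) + x ⬝ᵥ (signlessLaplacian Gᶜ *ᵥ x) =
      ((Fintype.card V : ℝ) - 2) * (x ⬝ᵥ x) + (∑ u, x u) ^ 2 := by
  -- Every off-diagonal pair lies in exactly one of the two graphs. The correction removes the
  -- diagonal, where the full square would be `4 * x u ^ 2`.
  have hpt : ∀ u v, ((if G.Adj u v then (x u + x v) ^ 2 else 0) +
      if Gᶜ.Adj u v then (x u + x v) ^ 2 else 0) =
      (x u ^ 2 + x v ^ 2 + 2 * (x u * x v)) - if u = v then 4 * x u ^ 2 else 0 := by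
    intro u v
    by_cases huv : u = v
    · subst huv
      simp
      ring
    · by_cases h : G.Adj u v <;> simp [huv, h] <;> ring
  simp only [dotProduct_signlessLaplacian_mulVec]
  rw [← add_div, ← Finset.sum_add_distrib]
  simp only [← Finset.sum_add_distrib, hpt]
  simp only [Finset.sum_sub_distrib, Finset.sum_add_distrib, ← Finset.mul_sum, ← Finset.sum_mul,
    Finset.sum_ite_eq, Finset.mem_univ, if_true, Finset.sum_const, Finset.card_univ,
    nsmul_eq_mul, dotProduct]
  simp only [← sq]
  ring

end QuadraticForm

/-- The form of a complete bipartite graph with parts of equal size, the parts being the level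
sets of the sign function `s`. -/
theorem sum_crossing_add_sq {V : Type*} [Fintype V] {s : V → ℝ}
    (hs : ∀ v, s v = 1 ∨ s v = -1) (h0 : ∑ v, s v = 0)
    (x : V → ℝ) :
    (∑ u, ∑ v, if s u = s v then 0 else (x u + x v) ^ 2) / 2 =
      (Fintype.card V : ℝ) / 2 * (x ⬝ᵥ x) + (∑ v, x v) ^ 2 / 2 - (∑ v, s v * x v) ^ 2 / 2 := by
  -- The indicator of a crossing pair is `(1 - s u * s v) / 2`; once expanded, each double sum
  -- factors.
  have hpt : ∀ u v, (if s u = s v then 0 else (x u + x v) ^ 2) =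
      (x u ^ 2 + x v ^ 2 + 2 * (x u * x v) - (s u * x u ^ 2) * s v - s u * (s v * x v ^ 2)
        - 2 * ((s u * x u) * (s v * x v))) / 2 := by
    intro u v
    rcases hs u with h | h <;>
    rcases hs v with h' | h' <;> rw [h, h'] <;> norm_num <;> ring
  simp only [hpt]
  simp only [← Finset.sum_div, Finset.sum_sub_distrib, Finset.sum_add_distrib, ← Finset.mul_sum,
    ← Finset.sum_mul, Finset.sum_const, Finset.card_univ, nsmul_eq_mul, dotProduct, h0]
  simp only [← sq]
  ring

end SignlessNG

namespace SignlessNG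

open Matrix

theorem _root_.SimpleGraph.Connected.apply_eq_of_forall_adj {V α : Type*} {G : SimpleGraph V}
    (hG : G.Connected)
    {f : V → α} (hf : ∀ u v, G.Adj u v → f u = f v) (u v : V) : f u = f v := by
  obtain ⟨p⟩ := hG.preconnected u v
  induction p with
  | nil => rfl
  | cons h _ ih => exact (hf _ _ h).trans ih

theorem dotProduct_self_pos_of_ne_zero {V : Type*} [Fintype V] {x : V → ℝ} (hx : x ≠ 0) :
    0 < x ⬝ᵥ x :=
  lt_of_le_of_ne (Finset.sum_nonneg fun v _ => mul_self_nonneg (x v))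
    fun h => hx (dotProduct_self_eq_zero.1 h.symm)

theorem dotProduct_self_const_add {V : Type*} [Fintype V] {z : V → ℝ} (hz : ∑ v, z v = 0)
    (c d : ℝ) : (fun v => c + d * z v) ⬝ᵥ (fun v => c + d * z v) =
      c ^ 2 * Fintype.card V + d ^ 2 * (z ⬝ᵥ z) := by
  have hpt : ∀ v, (c + d * z v) * (c + d * z v) =
      c ^ 2 + 2 * c * d * z v + d ^ 2 * (z v * z v) := fun v => by ring
  simp only [dotProduct, hpt, Finset.sum_add_distrib, ← Finset.mul_sum, hz, Finset.sum_const,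
    Finset.card_univ, nsmul_eq_mul]
  ring

theorem sum_const_add {V : Type*} [Fintype V] {z : V → ℝ} (hz : ∑ v, z v = 0) (c d : ℝ) :
    ∑ v, (c + d * z v) = c * Fintype.card V := by
  simp only [Finset.sum_add_distrib, ← Finset.mul_sum, hz, Finset.sum_const, Finset.card_univ,
    nsmul_eq_mul]
  ring

theorem bipartite_compl_form_nonneg {V : Type*} (G : SimpleGraph V) [DecidableRel G.Adj]
    (s x : V → ℝ) (u v : V) :
    0 ≤ if s u = s v ∨ G.Adj u v then 0 else (x u + x v) ^ 2 := by
  split_ifs <;> positivity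

theorem sum_bipartite_compl_form_nonneg {V : Type*} [Fintype V] (G : SimpleGraph V)
    [DecidableRel G.Adj] (s x : V → ℝ) :
    0 ≤ ∑ u, ∑ v, if s u = s v ∨ G.Adj u v then 0 else (x u + x v) ^ 2 :=
  Finset.sum_nonneg fun u _ => Finset.sum_nonneg fun v _ => bipartite_compl_form_nonneg G s x u v

/-! ### Bounds on `q₂` and their equality cases -/

section SecondEigenvalue

variable {V : Type*} [Fintype V] [DecidableEq V] (G : SimpleGraph V) [DecidableRel G.Adj]

theorem exists_form_ge_q₂ (hV : 2 ≤ Fintype.card V) :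
    ∃ x : V → ℝ, x ≠ 0 ∧ ∑ v, x v = 0 ∧
      q₂ G hV * (x ⬝ᵥ x) ≤ x ⬝ᵥ (signlessLaplacian G *ᵥ x) := by
  obtain ⟨x, hx, hw, h⟩ :=
    exists_orthogonal_eigenvalue_one_le (signlessLaplacian_isHermitian G) hV fun _ => 1
  exact ⟨x, hx, by simpa [dotProduct] using hw, h⟩

/-- The form value at `c • 1 + d • z` is a lower bound for `q₂` times the squared norm, for some
`(c, d) ≠ 0`. -/
theorem exists_form_le_q₂ (hV : 2 ≤ Fintype.card V) (z : V → ℝ) :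
    ∃ c d : ℝ, 0 < c ^ 2 + d ^ 2 ∧
      (fun v => c + d * z v) ⬝ᵥ (signlessLaplacian G *ᵥ (fun v => c + d * z v)) ≤
        q₂ G hV * ((fun v => c + d * z v) ⬝ᵥ (fun v => c + d * z v)) := by
  obtain ⟨c, d, hcd, h⟩ :=
    exists_combination_le_eigenvalue_one (signlessLaplacian_isHermitian G) hV (fun _ => 1) z
  have hx : (c • (fun _ => (1 : ℝ)) + d • z : V → ℝ) = fun v => c + d * z v := by
    ext v
    simp
  rw [hx] at h
  exact ⟨c, d, hcd, h⟩

theorem q₂_compl_le (hV : 2 ≤ Fintype.card V) : q₂ Gᶜ hV ≤ (Fintype.card V : ℝ) - 2 := by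
  obtain ⟨x, hx, h0, h⟩ := exists_form_ge_q₂ Gᶜ hV
  have hadd := signlessLaplacian_form_add_compl G x
  have hG := signlessLaplacian_form_nonneg G x
  rw [h0] at hadd
  exact le_of_mul_le_mul_right (by linarith) (dotProduct_self_pos_of_ne_zero hx)

variable {G}

/-- If the complement of a connected graph attains the bound of `q₂_compl_le`, then the graph is
bipartite with parts of equal size. -/
theorem exists_balanced_sign_of_q₂_compl_eq (hG : G.Connected) (hV : 2 ≤ Fintype.card V)
    (hq : q₂ Gᶜ hV = (Fintype.card V : ℝ) - 2) :
    ∃ s : V → ℝ, (∀ v, s v = 1 ∨ s v = -1) ∧ ∑ v, s v = 0 ∧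
      ∀ u v, G.Adj u v → s u ≠ s v := by
  obtain ⟨x, hx, h0, h⟩ := exists_form_ge_q₂ Gᶜ hV
  have hadd := signlessLaplacian_form_add_compl G x
  have hnn := signlessLaplacian_form_nonneg G x
  rw [h0] at hadd
  rw [hq] at h
  -- The form of `Gᶜ` already uses up `(n-2)|x|²`, so the form of `G` vanishes at `x`.
  have hz := (signlessLaplacian_form_eq_zero_iff G).1 (le_antisymm (by linarith) hnn)
  obtain ⟨w, hw⟩ := Function.ne_iff.1 hx
  rw [Pi.zero_apply] at hw
  have hsq : ∀ v, x v ^ 2 = x w ^ 2 := fun v =>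
    hG.apply_eq_of_forall_adj (f := fun v => x v ^ 2)
      (fun u v huv => by
        have : x u = -x v := by linarith [hz u v huv]
        simp [this]) v w
  refine ⟨fun v => x v / x w, fun v => ?_, by rw [← Finset.sum_div, h0, zero_div], ?_⟩
  · rcases sq_eq_sq_iff_eq_or_eq_neg.1 (hsq v) with h | h
    · left
      dsimp only
      rw [h, div_self hw]
    · right
      dsimp only
      rw [h, neg_div, div_self hw]
  · intro u v huv he
    have he' : x u = x v := by
      have := congrArg (· * x w) he
      simpa [hw] using this
    have hu : x u = 0 := by linarith [hz u v huv]
    have := hsq u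
    rw [hu] at this
    exact hw (by simpa using this.symm)

/-! ### Bipartite graphs with equal parts -/

section Balanced

variable {s : V → ℝ}

/-- The crossing pairs split into the edges of `G` and those of its bipartite complement. -/
theorem signlessLaplacian_form_add_bipartite_compl
    (hs : ∀ v, s v = 1 ∨ s v = -1) (h0 : ∑ v, s v = 0)
    (hadj : ∀ u v, G.Adj u v → s u ≠ s v)
    (x : V → ℝ) :
    x ⬝ᵥ (signlessLaplacian G *ᵥ x) +
        (∑ u, ∑ v, if s u = s v ∨ G.Adj u v then 0 else (x u + x v) ^ 2) / 2 =
      (Fintype.card V : ℝ) / 2 * (x ⬝ᵥ x) + (∑ v, x v) ^ 2 / 2 - (∑ v, s v * x v) ^ 2 / 2 := by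
  rw [← sum_crossing_add_sq hs h0, dotProduct_signlessLaplacian_mulVec, ← add_div]
  simp only [← Finset.sum_add_distrib]
  congr 1
  refine Finset.sum_congr rfl fun u _ => Finset.sum_congr rfl fun v _ => ?_
  by_cases h : G.Adj u v
  · simp [h, hadj u v h]
  · simp [h]

theorem q₂_le_of_balanced
    (hs : ∀ v, s v = 1 ∨ s v = -1) (h0 : ∑ v, s v = 0)
    (hadj : ∀ u v, G.Adj u v → s u ≠ s v)
    (hV : 2 ≤ Fintype.card V) : q₂ G hV ≤ (Fintype.card V : ℝ) / 2 := by
  obtain ⟨x, hx, hx0, h⟩ := exists_form_ge_q₂ G hV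
  have hadd := signlessLaplacian_form_add_bipartite_compl hs h0 hadj x
  have hnn := sum_bipartite_compl_form_nonneg G s x
  rw [hx0] at hadd
  exact le_of_mul_le_mul_right (by nlinarith [sq_nonneg (∑ v, s v * x v)])
    (dotProduct_self_pos_of_ne_zero hx)

/-- Two nonnegative terms are dropped in `q₂_le_of_balanced`: the square of `∑ v, s v * x v` and the
form of the bipartite complement. Equality makes both vanish. -/
theorem exists_kernel_of_q₂_eq
    (hs : ∀ v, s v = 1 ∨ s v = -1) (h0 : ∑ v, s v = 0)
    (hadj : ∀ u v, G.Adj u v → s u ≠ s v)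
    (hV : 2 ≤ Fintype.card V)
    (hq : q₂ G hV = (Fintype.card V : ℝ) / 2) :
    ∃ y : V → ℝ, y ≠ 0 ∧ ∑ v, y v = 0 ∧ ∑ v, s v * y v = 0 ∧
      ∀ u v, s u ≠ s v → ¬ G.Adj u v → y u + y v = 0 := by
  obtain ⟨x, hx, hx0, h⟩ := exists_form_ge_q₂ G hV
  have hadd := signlessLaplacian_form_add_bipartite_compl hs h0 hadj x
  have hnn := sum_bipartite_compl_form_nonneg G s x
  rw [hx0] at hadd
  rw [hq] at h
  refine ⟨x, hx, hx0, ?_, fun u v hu hv => ?_⟩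
  · exact pow_eq_zero_iff two_ne_zero |>.1
      (le_antisymm (by linarith) (sq_nonneg (∑ v, s v * x v)))
  · have hz : ∑ u, ∑ v, (if s u = s v ∨ G.Adj u v then 0 else (x u + x v) ^ 2) = 0 :=
      le_antisymm (by nlinarith [sq_nonneg (∑ v, s v * x v)]) hnn
    rw [Finset.sum_eq_zero_iff_of_nonneg fun u _ =>
      Finset.sum_nonneg fun v _ => bipartite_compl_form_nonneg G s x u v] at hz
    have hu' := hz u (Finset.mem_univ u)
    rw [Finset.sum_eq_zero_iff_of_nonneg fun v _ => bipartite_compl_form_nonneg G s x u v] at hu'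
    simpa [hu, hv] using hu' v (Finset.mem_univ v)

/-- At `c + d * y` the form exceeds `(n/2)|x|²` by `c² (4m - n²/2)`; `hE` says exactly that `4m -
n²/2` is nonnegative. -/
theorem q₂_eq_of_kernel
    (hs : ∀ v, s v = 1 ∨ s v = -1) (h0 : ∑ v, s v = 0)
    (hadj : ∀ u v, G.Adj u v → s u ≠ s v)
    (hV : 2 ≤ Fintype.card V)
    (hE : (Fintype.card V : ℝ) ^ 2 ≤ 8 * (G.edgeFinset.card : ℝ)) {y : V → ℝ} (hy : y ≠ 0)
    (hy0 : ∑ v, y v = 0) (hsy : ∑ v, s v * y v = 0)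
    (hker : ∀ u v, s u ≠ s v → ¬ G.Adj u v → y u + y v = 0) :
    q₂ G hV = (Fintype.card V : ℝ) / 2 := by
  refine le_antisymm (q₂_le_of_balanced hs h0 hadj hV) ?_
  obtain ⟨c, d, hcd, h⟩ := exists_form_le_q₂ G hV y
  have hx := signlessLaplacian_form_add_bipartite_compl hs h0 hadj fun v => c + d * y v
  have h1 := signlessLaplacian_form_add_bipartite_compl hs h0 hadj fun _ => 1
  have hN : (∑ u, ∑ v, if s u = s v ∨ G.Adj u v then 0 else
        ((c + d * y u) + (c + d * y v)) ^ 2) =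
      c ^ 2 * ∑ u, ∑ v, if s u = s v ∨ G.Adj u v then 0 else ((1 : ℝ) + 1) ^ 2 := by
    simp only [Finset.mul_sum]
    refine Finset.sum_congr rfl fun u _ => Finset.sum_congr rfl fun v _ => ?_
    split_ifs with huv
    · simp
    · rw [not_or] at huv
      have hv : y v = -y u := by linarith [hker u v huv.1 huv.2]
      rw [hv]
      ring
  have hs' : ∑ v, s v * (c + d * y v) = 0 := by
    have hpt : ∀ v, s v * (c + d * y v) = s v * c + d * (s v * y v) := fun v => by ring
    simp only [hpt, Finset.sum_add_distrib, ← Finset.mul_sum, ← Finset.sum_mul, h0, hsy]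
    ring
  rw [hN, sum_const_add hy0, hs'] at hx
  rw [signlessLaplacian_form_one] at h1
  simp only [dotProduct, mul_one, h0, Finset.sum_const, Finset.card_univ, nsmul_eq_mul] at h1
  have hpos : 0 < (fun v => c + d * y v) ⬝ᵥ (fun v => c + d * y v) := by
    rw [dotProduct_self_const_add hy0]
    have hyy := dotProduct_self_pos_of_ne_zero hy
    have hn : (0 : ℝ) < Fintype.card V := by exact_mod_cast (by omega : 0 < Fintype.card V)
    by_cases hc : c = 0
    · have : 0 < d ^ 2 := by simpa [hc] using hcd
      positivity
    · positivity
  refine le_of_mul_le_mul_right (le_trans ?_ h) hpos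
  set N := ∑ u, ∑ v, if s u = s v ∨ G.Adj u v then 0 else ((1 : ℝ) + 1) ^ 2
  have hN' : N = 2 * (Fintype.card V : ℝ) ^ 2 - 8 * (G.edgeFinset.card : ℝ) := by linarith
  rw [hN'] at hx
  nlinarith [mul_nonneg (sq_nonneg c) (sub_nonneg.2 hE)]

/-- At `c + d * s` the sign part cancels along every edge of `G`, so the form of `Gᶜ` exceeds
`(n-2)|x|²` by `c² (n² - 4m)`. -/
theorem q₂_compl_eq_of_balanced
    (hs : ∀ v, s v = 1 ∨ s v = -1) (h0 : ∑ v, s v = 0)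
    (hadj : ∀ u v, G.Adj u v → s u ≠ s v)
    (hV : 2 ≤ Fintype.card V) :
    q₂ Gᶜ hV = (Fintype.card V : ℝ) - 2 := by
  refine le_antisymm (q₂_compl_le G hV) ?_
  obtain ⟨c, d, hcd, h⟩ := exists_form_le_q₂ Gᶜ hV s
  have hx := signlessLaplacian_form_add_compl G fun v => c + d * s v
  -- Dropping the bipartite complement's form at the all-ones vector gives `4m ≤ n²`.
  have h1 := (le_add_of_nonneg_right
    (div_nonneg (sum_bipartite_compl_form_nonneg G s fun _ => 1) zero_le_two)).trans_eq
    (signlessLaplacian_form_add_bipartite_compl hs h0 hadj fun _ => 1)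
  have hform : (fun v => c + d * s v) ⬝ᵥ (signlessLaplacian G *ᵥ fun v => c + d * s v) =
      c ^ 2 * ((fun _ => (1 : ℝ)) ⬝ᵥ (signlessLaplacian G *ᵥ (fun _ => 1))) := by
    simp only [dotProduct_signlessLaplacian_mulVec, mul_div_assoc', Finset.mul_sum]
    congr 1
    refine Finset.sum_congr rfl fun u _ => Finset.sum_congr rfl fun v _ => ?_
    split_ifs with huv
    · have hv : s v = -s u := by
        have := hadj u v huv
        rcases hs u with hu | hu <;> rcases hs v with hv | hv <;> rw [hu, hv] at this ⊢ <;> simp_all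
      rw [hv]
      ring
    · simp
  rw [hform, sum_const_add h0] at hx
  simp only [mul_one, h0, Finset.sum_const, Finset.card_univ, nsmul_eq_mul] at h1
  have h11 : (fun _ : V => (1 : ℝ)) ⬝ᵥ (fun _ => 1) = Fintype.card V := by simp [dotProduct]
  rw [h11] at h1
  have hpos : 0 < (fun v => c + d * s v) ⬝ᵥ (fun v => c + d * s v) := by
    have hn : (0 : ℝ) < Fintype.card V := by exact_mod_cast (by omega : 0 < Fintype.card V)
    have hss : s ⬝ᵥ s = Fintype.card V := by
      have : ∀ v, s v * s v = 1 := fun v => by rcases hs v with h | h <;> rw [h] <;> norm_num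
      simp [dotProduct, this]
    rw [dotProduct_self_const_add h0, hss, ← add_mul]
    positivity
  refine le_of_mul_le_mul_right (le_trans ?_ h) hpos
  set F := (fun _ => (1 : ℝ)) ⬝ᵥ (signlessLaplacian G *ᵥ (fun _ => 1))
  have hF : F ≤ (Fintype.card V : ℝ) ^ 2 := by linarith
  nlinarith [mul_nonneg (sq_nonneg c) (sub_nonneg.2 hF)]

end Balanced

end SecondEigenvalue

end SignlessNG

namespace SignlessNG

/-! ### Classification of 3 × 3 biadjacency matrices -/

section Biadjacency

/-- The bipartite graph with a given biadjacency matrix. -/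
def ofBiadjacency {α β : Type*} (B : α → β → Bool) : SimpleGraph (α ⊕ β) where
  Adj u v := (∃ i j, u = .inl i ∧ v = .inr j ∧ B i j) ∨ ∃ i j, v = .inl i ∧ u = .inr j ∧ B i j
  symm := ⟨fun _ _ h => h.symm⟩
  loopless := ⟨by
    rintro u (⟨i, j, h, h', -⟩ | ⟨i, j, h, h', -⟩) <;> simp [h] at h'⟩

section

variable {α β : Type*} (B : α → β → Bool)

@[simp]
theorem ofBiadjacency_adj_inl_inr (i : α) (j : β) :
    (ofBiadjacency B).Adj (.inl i) (.inr j) ↔ B i j := by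
  simp [ofBiadjacency]

@[simp]
theorem ofBiadjacency_adj_inr_inl (i : α) (j : β) :
    (ofBiadjacency B).Adj (.inr j) (.inl i) ↔ B i j := by
  simp [ofBiadjacency]

@[simp]
theorem not_ofBiadjacency_adj_inl_inl (i i' : α) :
    ¬ (ofBiadjacency B).Adj (.inl i) (.inl i') := by
  simp [ofBiadjacency]

@[simp]
theorem not_ofBiadjacency_adj_inr_inr (j j' : β) :
    ¬ (ofBiadjacency B).Adj (.inr j) (.inr j') := by
  simp [ofBiadjacency]

/-- Permuting rows and columns of the biadjacency matrix. -/
def ofBiadjacencyPermIso (σ : Equiv.Perm α) (τ : Equiv.Perm β) :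
    ofBiadjacency (fun i j => B (σ i) (τ j)) ≃g ofBiadjacency B where
  toEquiv := Equiv.sumCongr σ τ
  map_rel_iff' := by rintro (i | i) (j | j) <;> simp

/-- Transposing the biadjacency matrix. -/
def ofBiadjacencyTransposeIso : ofBiadjacency (fun j i => B i j) ≃g ofBiadjacency B where
  toEquiv := Equiv.sumComm β α
  map_rel_iff' := by rintro (i | i) (j | j) <;> simp

end

/-- There is a nonzero vector that sums to zero on both parts and takes opposite values at the ends
of each pair missing from the bipartite graph. -/
def HasBalancedKernel {α β : Type*} [Fintype α] [Fintype β] (B : α → β → Bool) : Prop :=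
  ∃ (y : α → ℝ) (z : β → ℝ), (y ≠ 0 ∨ z ≠ 0) ∧ ∑ i, y i = 0 ∧ ∑ j, z j = 0 ∧
    ∀ i j, B i j = false → y i + z j = 0

section

variable {α β : Type*} [Fintype α] [Fintype β] {B : α → β → Bool}

theorem HasBalancedKernel.perm (h : HasBalancedKernel B) (σ : Equiv.Perm α) (τ : Equiv.Perm β) :
    HasBalancedKernel fun i j => B (σ i) (τ j) := by
  obtain ⟨y, z, hyz, hy, hz, hB⟩ := h
  refine ⟨y ∘ σ, z ∘ τ, ?_, ?_, ?_, fun i j h => hB _ _ h⟩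
  · refine hyz.imp (fun h h' => h ?_) (fun h h' => h ?_)
    · ext i
      simpa using congrFun h' (σ.symm i)
    · ext j
      simpa using congrFun h' (τ.symm j)
  · rw [← hy]
    exact Equiv.sum_comp σ y
  · rw [← hz]
    exact Equiv.sum_comp τ z

theorem HasBalancedKernel.transpose (h : HasBalancedKernel B) :
    HasBalancedKernel fun j i => B i j := by
  obtain ⟨y, z, hyz, hy, hz, hB⟩ := h
  exact ⟨z, y, hyz.symm, hz, hy, fun j i h => by rw [add_comm, hB i j h]⟩

/-- With integer vectors the conditions become decidable. -/
theorem hasBalancedKernel_of_int (y : α → ℤ) (z : β → ℤ)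
    (h : ((∃ i, y i ≠ 0) ∨ ∃ j, z j ≠ 0) ∧ ∑ i, y i = 0 ∧ ∑ j, z j = 0 ∧
      ∀ i j, B i j = false → y i + z j = 0) : HasBalancedKernel B := by
  obtain ⟨hyz, hy, hz, hB⟩ := h
  refine ⟨fun i => y i, fun j => z j, ?_, by dsimp only; exact_mod_cast hy,
    by dsimp only; exact_mod_cast hz, fun i j h => by dsimp only; exact_mod_cast hB i j h⟩
  refine hyz.imp ?_ ?_
  · rintro ⟨i, hi⟩ h
    exact hi (by simpa using congrFun h i)
  · rintro ⟨i, hi⟩ h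
    exact hi (by simpa using congrFun h i)

end

/-- The biadjacency matrices of the graphs `H₁`, …, `H₈` and of `K_{3,3}`. -/
def extremalBiadjacency : List (Fin 3 → Fin 3 → Bool) :=
  [![![true, true, false], ![false, true, true], ![false, false, true]],
   ![![true, true, true], ![true, false, false], ![true, false, false]],
   ![![true, true, false], ![true, true, true], ![false, false, true]],
   ![![true, true, false], ![true, true, true], ![false, true, false]],
   ![![false, true, true], ![true, false, true], ![true, true, false]],
   ![![true, true, false], ![true, true, false], ![true, true, true]],
   ![![true, true, false], ![true, true, true], ![false, true, true]],
   ![![true, true, true], ![true, true, true], ![true, true, false]],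
   ![![true, true, true], ![true, true, true], ![true, true, true]]]

/-- The tree obtained from the star `K_{1,3}` by subdividing two of its edges. -/
def spiderBiadjacency : Fin 3 → Fin 3 → Bool :=
  ![![true, true, true], ![true, false, false], ![false, true, false]]

theorem hasBalancedKernel_of_mem {T : Fin 3 → Fin 3 → Bool} (hT : T ∈ extremalBiadjacency) :
    HasBalancedKernel T := by
  simp only [extremalBiadjacency, List.mem_cons, List.not_mem_nil, or_false] at hT
  rcases hT with rfl | rfl | rfl | rfl | rfl | rfl | rfl | rfl | rfl
  · exact hasBalancedKernel_of_int ![-2, 1, 1] ![-1, -1, 2] (by decide)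
  · exact hasBalancedKernel_of_int ![-2, 1, 1] ![2, -1, -1] (by decide)
  · exact hasBalancedKernel_of_int ![-2, 1, 1] ![-1, -1, 2] (by decide)
  · exact hasBalancedKernel_of_int ![1, -2, 1] ![-1, 2, -1] (by decide)
  · exact hasBalancedKernel_of_int ![1, -1, 0] ![-1, 1, 0] (by decide)
  · exact hasBalancedKernel_of_int ![1, 1, -2] ![1, 0, -1] (by decide)
  · exact hasBalancedKernel_of_int ![1, -1, 0] ![0, 1, -1] (by decide)
  · exact hasBalancedKernel_of_int ![0, 1, -1] ![-1, 0, 1] (by decide)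
  · exact hasBalancedKernel_of_int ![1, -1, 0] ![0, 0, 0] (by decide)

/-- The four missing pairs force `z` to be constant, hence zero, and then `y 1`, `y 2` and `y 0`
vanish too. -/
theorem not_hasBalancedKernel_spider : ¬ HasBalancedKernel spiderBiadjacency := by
  rintro ⟨y, z, hyz, hy, hz, hB⟩
  have h11 := hB 1 1 rfl
  have h12 := hB 1 2 rfl
  have h20 := hB 2 0 rfl
  have h22 := hB 2 2 rfl
  rw [Fin.sum_univ_three] at hy hz
  rcases hyz with h | h <;> refine h (funext fun i => ?_) <;> rw [Pi.zero_apply] <;>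
    fin_cases i <;> simp only [Fin.zero_eta, Fin.mk_one, Fin.reduceFinMk] <;> linarith

/-- The permutations of three letters. -/
def permsFinThree : List (Equiv.Perm (Fin 3)) :=
  [1, Equiv.swap 0 1, Equiv.swap 0 2, Equiv.swap 1 2, finRotate 3, (finRotate 3)⁻¹]

theorem exists_mem_permsFinThree : ∀ j j' : Fin 3, j ≠ j' →
    ∃ τ ∈ permsFinThree, τ 0 = j ∧ τ 1 = j' := by
  decide

/-- The number of edges of the bipartite graph, as a sum that evaluates quickly. -/
def biadjacencyEdgeCount (B : Fin 3 → Fin 3 → Bool) : ℕ :=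
  (B 0 0).toNat + (B 0 1).toNat + (B 0 2).toNat + (B 1 0).toNat + (B 1 1).toNat + (B 1 2).toNat +
    (B 2 0).toNat + (B 2 1).toNat + (B 2 2).toNat

-- If no row has two entries `true`, there are at most three edges, too few to connect six vertices.
-- A cut is a nonconstant labelling, `true` at row 0, that agrees along edges.
set_option maxRecDepth 100000 in
theorem exists_row_or_cut : ∀ a b c d e f g h i : Bool,
    (∃ k l l', l ≠ l' ∧ ![![a, b, c], ![d, e, f], ![g, h, i]] k l = true ∧
      ![![a, b, c], ![d, e, f], ![g, h, i]] k l' = true) ∨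
    ∃ S₁ S₂ T₀ T₁ T₂ : Bool,
      ((∃ k, ![true, S₁, S₂] k = false) ∨ ∃ k, ![T₀, T₁, T₂] k = false) ∧
      ∀ k l, ![![a, b, c], ![d, e, f], ![g, h, i]] k l = true →
        ![true, S₁, S₂] k = ![T₀, T₁, T₂] l := by
  decide +kernel

-- Fixing two entries of the first row leaves 128 matrices to test, and forces the cut labels of
-- columns 0 and 1. The edge count rejects most candidates `T` before permutations are searched.
set_option maxRecDepth 100000 in
theorem cut_or_equivalent : ∀ c d e f g h i : Bool,
    (∃ S₁ S₂ T₂ : Bool,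
      ((∃ k, ![true, S₁, S₂] k = false) ∨ ∃ k, ![true, true, T₂] k = false) ∧
      ∀ k l, ![![true, true, c], ![d, e, f], ![g, h, i]] k l = true →
        ![true, S₁, S₂] k = ![true, true, T₂] l) ∨
    ∃ T ∈ spiderBiadjacency :: extremalBiadjacency,
      biadjacencyEdgeCount ![![true, true, c], ![d, e, f], ![g, h, i]] = biadjacencyEdgeCount T ∧
      ∃ σ ∈ permsFinThree, ∃ τ ∈ permsFinThree,
        (∀ k l, ![![true, true, c], ![d, e, f], ![g, h, i]] (σ k) (τ l) = T k l) ∨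
        (∀ k l, ![![true, true, c], ![d, e, f], ![g, h, i]] (σ k) (τ l) = T l k) := by
  decide +kernel

theorem finThree_matrix_eta {α : Type*} (B : Fin 3 → Fin 3 → α) :
    ![![B 0 0, B 0 1, B 0 2], ![B 1 0, B 1 1, B 1 2], ![B 2 0, B 2 1, B 2 2]] = B := by
  ext k l
  fin_cases k <;> fin_cases l <;> rfl

theorem not_cut_of_connected {α β : Type*} {B : α → β → Bool} (hB : (ofBiadjacency B).Connected)
    {S : α → Bool} {T : β → Bool} (h : ∀ k l, B k l = true → S k = T l) {k₀ : α}
    (h₀ : S k₀ = true) : ¬ ((∃ k, S k = false) ∨ ∃ l, T l = false) := by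
  have hconst := hB.apply_eq_of_forall_adj (f := Sum.elim S T) (by
    rintro (u | u) (v | v) huv
    · simp at huv
    · exact h u v (by simpa using huv)
    · exact (h v u (by simpa using huv)).symm
    · simp at huv)
  rintro (⟨k, hk⟩ | ⟨l, hl⟩)
  · have : S k = S k₀ := hconst (.inl k) (.inl k₀)
    simp [hk, h₀] at this
  · have : T l = S k₀ := hconst (.inr l) (.inl k₀)
    simp [hl, h₀] at this

theorem exists_extremal_iso_of_row {B : Fin 3 → Fin 3 → Bool} (hB : (ofBiadjacency B).Connected)
    (hker : HasBalancedKernel B) (h00 : B 0 0 = true) (h01 : B 0 1 = true) :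
    ∃ T ∈ extremalBiadjacency, Nonempty (ofBiadjacency B ≃g ofBiadjacency T) := by
  have heta := finThree_matrix_eta B
  rw [h00, h01] at heta
  have key := cut_or_equivalent (B 0 2) (B 1 0) (B 1 1) (B 1 2) (B 2 0) (B 2 1) (B 2 2)
  rw [heta] at key
  have spider : ∀ T ∈ spiderBiadjacency :: extremalBiadjacency, HasBalancedKernel T →
      T ∈ extremalBiadjacency := by
    intro T hT hTk
    rcases List.mem_cons.1 hT with rfl | h
    · exact absurd hTk not_hasBalancedKernel_spider
    · exact h
  rcases key with ⟨S₁, S₂, T₂, hST, hcut⟩ | ⟨T, hT, -, σ, -, τ, -, h | h⟩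
  · exact absurd hST (not_cut_of_connected hB hcut (k₀ := 0) rfl)
  · obtain rfl : (fun k l => B (σ k) (τ l)) = T := by
      ext k l
      rw [h]
    exact ⟨_, spider _ hT (hker.perm σ τ), ⟨(ofBiadjacencyPermIso B σ τ).symm⟩⟩
  · obtain rfl : (fun l k => B (σ k) (τ l)) = T := by
      ext k l
      rw [h]
    exact ⟨_, spider _ hT (hker.perm σ τ).transpose,
      ⟨((ofBiadjacencyTransposeIso fun k l => B (σ k) (τ l)).trans
        (ofBiadjacencyPermIso B σ τ)).symm⟩⟩

theorem exists_extremal_iso {B : Fin 3 → Fin 3 → Bool} (hB : (ofBiadjacency B).Connected)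
    (hker : HasBalancedKernel B) :
    ∃ T ∈ extremalBiadjacency, Nonempty (ofBiadjacency B ≃g ofBiadjacency T) := by
  have key := exists_row_or_cut (B 0 0) (B 0 1) (B 0 2) (B 1 0) (B 1 1) (B 1 2)
    (B 2 0) (B 2 1) (B 2 2)
  rw [finThree_matrix_eta B] at key
  rcases key with ⟨k, l, l', hll, hl, hl'⟩ | ⟨S₁, S₂, T₀, T₁, T₂, hST, hcut⟩
  -- Move the row with two `true` entries to the top and those entries to the first two columns.
  · obtain ⟨τ, -, rfl, rfl⟩ := exists_mem_permsFinThree l l' hll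
    let φ := ofBiadjacencyPermIso B (Equiv.swap 0 k) τ
    obtain ⟨T, hT, ⟨ψ⟩⟩ := exists_extremal_iso_of_row (φ.connected_iff.2 hB)
      (hker.perm (Equiv.swap 0 k) τ) (by simpa using hl) (by simpa using hl')
    exact ⟨T, hT, ⟨φ.symm.trans ψ⟩⟩
  · exact absurd hST (not_cut_of_connected hB hcut (k₀ := 0) rfl)

end Biadjacency

/-! ### From matrices to graphs on six vertices -/

section SixVertices

/-- A six-vertex graph with all edges between the two rows is given by its biadjacency matrix. -/
theorem nonempty_sixGraph_iso (E : Finset (Sym2 (Fin 6))) (T : Fin 3 → Fin 3 → Bool)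
    (hT : ∀ i j : Fin 3, (s(Fin.castAdd 3 i, Fin.natAdd 3 j) ∈ E ↔ T i j) ∧
      s(Fin.castAdd 3 i, Fin.castAdd 3 j) ∉ E ∧ s(Fin.natAdd 3 i, Fin.natAdd 3 j) ∉ E) :
    Nonempty (ofBiadjacency T ≃g sixGraph E) := by
  have hne : ∀ i j : Fin 3, Fin.castAdd 3 i ≠ Fin.natAdd 3 j := by decide
  have hadj : ∀ u v, (sixGraph E).Adj u v ↔ s(u, v) ∈ E ∧ u ≠ v := by simp [sixGraph]
  refine ⟨⟨finSumFinEquiv, ?_⟩⟩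
  rintro (i | i) (j | j) <;> rw [hadj]
  · exact iff_of_false (fun h => (hT i j).2.1 h.1) (by simp)
  · rw [finSumFinEquiv_apply_left, finSumFinEquiv_apply_right, (hT i j).1,
      and_iff_left (hne i j), ofBiadjacency_adj_inl_inr]
  · rw [finSumFinEquiv_apply_left, finSumFinEquiv_apply_right, Sym2.eq_swap, (hT j i).1,
      and_iff_left (hne j i).symm, ofBiadjacency_adj_inr_inl]
  · exact iff_of_false (fun h => (hT i j).2.2 h.1) (by simp)

theorem nonempty_completeBipartite_iso :
    Nonempty (ofBiadjacency
      ![![true, true, true], ![true, true, true], ![true, true, true]] ≃g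
        completeBipartiteGraph (Fin 3) (Fin 3)) := by
  have h : ∀ i j : Fin 3,
      ![![true, true, true], ![true, true, true], ![true, true, true]] i j = true := by decide
  refine ⟨⟨Equiv.refl _, ?_⟩⟩
  rintro (i | i) (j | j) <;> simp [h]

theorem exists_extremal_iso_iff {V : Type*} (G : SimpleGraph V) :
    (∃ T ∈ extremalBiadjacency, Nonempty (G ≃g ofBiadjacency T)) ↔
      Nonempty (G ≃g H₁) ∨ Nonempty (G ≃g H₂) ∨ Nonempty (G ≃g H₃) ∨ Nonempty (G ≃g H₄) ∨
      Nonempty (G ≃g H₅) ∨ Nonempty (G ≃g H₆) ∨ Nonempty (G ≃g H₇) ∨ Nonempty (G ≃g H₈) ∨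
      Nonempty (G ≃g completeBipartiteGraph (Fin 3) (Fin 3)) := by
  have key : ∀ {W : Type} {K : SimpleGraph W} {T : Fin 3 → Fin 3 → Bool},
      Nonempty (ofBiadjacency T ≃g K) →
        (Nonempty (G ≃g ofBiadjacency T) ↔ Nonempty (G ≃g K)) :=
    fun ⟨e⟩ => ⟨fun ⟨f⟩ => ⟨f.trans e⟩, fun ⟨f⟩ => ⟨f.trans e.symm⟩⟩
  simp only [extremalBiadjacency, List.exists_mem_cons_iff, List.not_mem_nil, false_and,
    exists_false, or_false]
  rw [key (nonempty_sixGraph_iso _ _ (by decide) : Nonempty (_ ≃g H₁)),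
    key (nonempty_sixGraph_iso _ _ (by decide) : Nonempty (_ ≃g H₂)),
    key (nonempty_sixGraph_iso _ _ (by decide) : Nonempty (_ ≃g H₃)),
    key (nonempty_sixGraph_iso _ _ (by decide) : Nonempty (_ ≃g H₄)),
    key (nonempty_sixGraph_iso _ _ (by decide) : Nonempty (_ ≃g H₅)),
    key (nonempty_sixGraph_iso _ _ (by decide) : Nonempty (_ ≃g H₆)),
    key (nonempty_sixGraph_iso _ _ (by decide) : Nonempty (_ ≃g H₇)),
    key (nonempty_sixGraph_iso _ _ (by decide) : Nonempty (_ ≃g H₈)),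
    key nonempty_completeBipartite_iso]
  rfl

variable {V : Type*} [Fintype V] {G : SimpleGraph V}

theorem exists_equiv_of_balanced_sign {s : V → ℝ} (hV : Fintype.card V = 6)
    (hs : ∀ v, s v = 1 ∨ s v = -1) (h0 : ∑ v, s v = 0) :
    ∃ e : Fin 3 ⊕ Fin 3 ≃ V, (∀ i, s (e (.inl i)) = 1) ∧ ∀ j, s (e (.inr j)) = -1 := by
  classical
  have hsum : (Fintype.card {v // s v = 1} : ℝ) - Fintype.card {v // ¬ s v = 1} = 0 := by
    rw [← h0, ← (Equiv.sumCompl fun v => s v = 1).sum_comp, Fintype.sum_sum_type]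
    have h1 : ∀ v : {v // s v = 1}, s v = 1 := fun v => v.2
    have h2 : ∀ v : {v // ¬ s v = 1}, s v = -1 := fun v => (hs v).resolve_left v.2
    simp [h1, h2, sub_eq_add_neg]
  have hadd : Fintype.card {v // s v = 1} + Fintype.card {v // ¬ s v = 1} = 6 := by
    rw [← Fintype.card_sum, Fintype.card_congr (Equiv.sumCompl fun v => s v = 1), hV]
  have heq : Fintype.card {v // s v = 1} = Fintype.card {v // ¬ s v = 1} := by
    exact_mod_cast sub_eq_zero.1 hsum
  let e₁ : Fin 3 ≃ {v // s v = 1} := (Fintype.equivFinOfCardEq (by omega)).symm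
  let e₂ : Fin 3 ≃ {v // ¬ s v = 1} := (Fintype.equivFinOfCardEq (by omega)).symm
  refine ⟨(Equiv.sumCongr e₁ e₂).trans (Equiv.sumCompl fun v => s v = 1), fun i => ?_, fun j => ?_⟩
  · simpa using (e₁ i).2
  · simpa using (hs _).resolve_left (e₂ j).2

theorem exists_extremal_iso_of_kernel (hG : G.Connected) (hV : Fintype.card V = 6) {s y : V → ℝ}
    (hs : ∀ v, s v = 1 ∨ s v = -1) (h0 : ∑ v, s v = 0) (hadj : ∀ u v, G.Adj u v → s u ≠ s v)
    (hy : y ≠ 0) (hy0 : ∑ v, y v = 0) (hsy : ∑ v, s v * y v = 0)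
    (hker : ∀ u v, s u ≠ s v → ¬ G.Adj u v → y u + y v = 0) :
    ∃ T ∈ extremalBiadjacency, Nonempty (G ≃g ofBiadjacency T) := by
  classical
  obtain ⟨e, hl, hr⟩ := exists_equiv_of_balanced_sign hV hs h0
  let B : Fin 3 → Fin 3 → Bool := fun i j => decide (G.Adj (e (.inl i)) (e (.inr j)))
  let φ : ofBiadjacency B ≃g G := ⟨e, by
    rintro (i | i) (j | j)
    · simpa using fun h => hadj _ _ h (by rw [hl, hl])
    · simp [B]
    · simp [B, G.adj_comm]
    · simpa using fun h => hadj _ _ h (by rw [hr, hr])⟩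
  have hB : HasBalancedKernel B := by
    rw [← e.sum_comp, Fintype.sum_sum_type] at hy0 hsy
    simp only [hl, hr, one_mul, neg_mul, Finset.sum_neg_distrib] at hsy
    refine ⟨fun i => y (e (.inl i)), fun j => y (e (.inr j)), ?_, by linarith, by linarith,
      fun i j h => hker _ _ (by rw [hl, hr]; norm_num) (by simpa [B] using h)⟩
    by_contra! h
    refine hy (funext fun v => ?_)
    obtain ⟨u, rfl⟩ := e.surjective v
    rcases u with i | j
    · exact congrFun h.1 i
    · exact congrFun h.2 j
  obtain ⟨T, hT, ⟨ψ⟩⟩ := exists_extremal_iso (φ.connected_iff.2 hG) hB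
  exact ⟨T, hT, ⟨φ.symm.trans ψ⟩⟩

theorem exists_kernel_of_extremal_iso {T : Fin 3 → Fin 3 → Bool} (hT : HasBalancedKernel T)
    (e : G ≃g ofBiadjacency T) :
    ∃ s y : V → ℝ, (∀ v, s v = 1 ∨ s v = -1) ∧ ∑ v, s v = 0 ∧ (∀ u v, G.Adj u v → s u ≠ s v) ∧
      y ≠ 0 ∧ ∑ v, y v = 0 ∧ ∑ v, s v * y v = 0 ∧
      ∀ u v, s u ≠ s v → ¬ G.Adj u v → y u + y v = 0 := by
  obtain ⟨a, b, hab, ha, hb, hker⟩ := hT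
  have he : ∀ w, e (e.toEquiv.symm w) = w := e.toEquiv.apply_symm_apply
  refine ⟨Sum.elim (fun _ => 1) (fun _ => -1) ∘ e, Sum.elim a b ∘ e, fun v => ?_, ?_, ?_, ?_, ?_,
    ?_, ?_⟩
  · rcases h : e v with i | j <;> simp [h]
  · rw [← e.toEquiv.symm.sum_comp, Fintype.sum_sum_type]
    simp only [Function.comp_apply, he]
    simp
  · intro u v huv
    rw [← e.map_adj_iff] at huv
    rcases h : e u with i | i <;> rcases h' : e v with j | j <;> rw [h, h'] at huv <;>
      simp [h, h'] at huv ⊢ <;> norm_num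
  · intro h
    rcases hab with h' | h'
    · exact h' (funext fun i => by simpa using congrFun h (e.symm (.inl i)))
    · exact h' (funext fun i => by simpa using congrFun h (e.symm (.inr i)))
  · rw [← e.toEquiv.symm.sum_comp, Fintype.sum_sum_type]
    simp only [Function.comp_apply, he]
    simp [ha, hb]
  · rw [← e.toEquiv.symm.sum_comp, Fintype.sum_sum_type]
    simp only [Function.comp_apply, he]
    simp [ha, hb]
  · intro u v hs huv
    rw [← e.map_adj_iff] at huv
    rcases h : e u with i | i <;> rcases h' : e v with j | j <;> rw [h, h'] at huv <;>
      simp only [Function.comp_apply, h, h', Sum.elim_inl, Sum.elim_inr, ne_eq,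
        not_true_eq_false] at hs ⊢
    · exact hker i j (by simpa using huv)
    · rw [add_comm]
      exact hker j i (by simpa using huv)

end SixVertices

end SignlessNG

/-! ### The sum bound and its equality case -/

theorem theorem5 {V : Type*} [Fintype V] [DecidableEq V] (G : SimpleGraph V) [DecidableRel G.Adj]
    (hconn : G.Connected) (hn : 6 ≤ Fintype.card V)
    (hq : SignlessNG.q₂ G (le_trans (by norm_num) hn) ≤ (Fintype.card V : ℝ) - 3) :
    SignlessNG.q₂ G (le_trans (by norm_num) hn) + SignlessNG.q₂ Gᶜ (le_trans (by norm_num) hn) ≤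
        2 * (Fintype.card V : ℝ) - 5 ∧
      (SignlessNG.q₂ G (le_trans (by norm_num) hn) + SignlessNG.q₂ Gᶜ (le_trans (by norm_num) hn) =
          2 * (Fintype.card V : ℝ) - 5 ↔
        Nonempty (G ≃g SignlessNG.H₁) ∨ Nonempty (G ≃g SignlessNG.H₂) ∨
        Nonempty (G ≃g SignlessNG.H₃) ∨ Nonempty (G ≃g SignlessNG.H₄) ∨
        Nonempty (G ≃g SignlessNG.H₅) ∨ Nonempty (G ≃g SignlessNG.H₆) ∨
        Nonempty (G ≃g SignlessNG.H₇) ∨ Nonempty (G ≃g SignlessNG.H₈) ∨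
        Nonempty (G ≃g completeBipartiteGraph (Fin 3) (Fin 3))) := by
  have hV : 2 ≤ Fintype.card V := le_trans (by norm_num) hn
  have hc := SignlessNG.q₂_compl_le G hV
  refine ⟨by linarith, ?_⟩
  rw [← SignlessNG.exists_extremal_iso_iff]
  constructor
  · intro h
    obtain ⟨s, hs, h0, hadj⟩ :=
      SignlessNG.exists_balanced_sign_of_q₂_compl_eq hconn hV (by linarith)
    have hle := SignlessNG.q₂_le_of_balanced hs h0 hadj hV
    have hcard : Fintype.card V = 6 := by
      -- Equality forces `q₂(G) = n - 3`, which is at most `n/2`.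
      have : (Fintype.card V : ℝ) ≤ 6 := by linarith
      exact le_antisymm (by exact_mod_cast this) hn
    have hcard' : (Fintype.card V : ℝ) = 6 := by exact_mod_cast hcard
    obtain ⟨y, hy, hy0, hsy, hker⟩ :=
      SignlessNG.exists_kernel_of_q₂_eq hs h0 hadj hV (by linarith)
    exact SignlessNG.exists_extremal_iso_of_kernel hconn hcard hs h0 hadj hy hy0 hsy hker
  · rintro ⟨T, hT, ⟨e⟩⟩
    have hcard : Fintype.card V = 6 := by
      simpa using Fintype.card_congr e.toEquiv
    have hcard' : (Fintype.card V : ℝ) = 6 := by exact_mod_cast hcard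
    -- Connectedness gives `m ≥ 5`, so `8m ≥ 40 ≥ 36 = n²`, as `q₂_eq_of_kernel` requires.
    have hE : 6 ≤ G.edgeFinset.card + 1 := by
      have := hconn.card_vert_le_card_edgeSet_add_one
      rwa [Nat.card_eq_fintype_card, Nat.card_eq_fintype_card, hcard,
        ← SimpleGraph.edgeFinset_card] at this
    have hE' : (6 : ℝ) ≤ G.edgeFinset.card + 1 := by exact_mod_cast hE
    obtain ⟨s, y, hs, h0, hadj, hy, hy0, hsy, hker⟩ :=
      SignlessNG.exists_kernel_of_extremal_iso (SignlessNG.hasBalancedKernel_of_mem hT) e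
    rw [SignlessNG.q₂_eq_of_kernel hs h0 hadj hV (by rw [hcard']; linarith) hy hy0 hsy hker,
      SignlessNG.q₂_compl_eq_of_balanced hs h0 hadj hV, hcard']
    norm_num
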